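/- Let $G$ be a polycyclic-by-finite group, that is, a group with a normal subgroup $N$ of finite index and a series $\{1\}=N_0\subset N_1\subset\dots\subset N_n=N$ in which each $N_{k-1}$ is normal in $N_k$ with $N_k/N_{k-1}$ cyclic. Let $V$ be an algebraic group over an algebraically closed field $K$ (a group scheme of finite type over $K$, not necessarily affine, connected or reduced). $V$ and its powers are identified with their groups of $K$-points. An algebraic subgroup of $V^E$, for a finite set $E$, is a Zariski closed subgroup. Let $G$ act on $V^G$ by $(gx)(h)=x(g^{-1}h)$. A $G$-invariant subset $\Sigma\subset V^G$ is an *algebraic group subshift* if it is closed for the prodiscrete topology (the product of the discrete topologies on the factors $V$) and if for every finite $E\subset G$ the restriction $\Sigma_E=\{x|_E : x\in\Sigma\}$ is an algebraic subgroup of $V^E$. A subset of $V^G$ is an *algebraic group subshift of finite type* if it has the form $\{x\in V^G : (g^{-1}x)|_D\in W \text{ for all } g\in G\}$ for some finite $D\subset G$ and some algebraic subgroup $W\subset V^D$. A map $\tau\colon\Sigma\to\Sigma$ is an *algebraic group cellular automaton* if there are a finite set $M\subset G$ and a homomorphism of $K$-algebraic groups $\mu\colon V^M\to V$ such that $\tau(x)(g)=\mu((g^{-1}x)|_M)$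 for all $x\in\Sigma$ and $g\in G$. Let $\Sigma$ be an algebraic group subshift of $V^G$ and let $\tau\colon\Sigma\to\Sigma$ be an algebraic group cellular automaton. Then the limit set $\Omega(\tau)=\bigcap_{n\ge 1}\tau^n(\Sigma)$ is an algebraic group subshift of finite type of $V^G$, and $\tau$ is stable, i.e. $\tau^{n+1}(\Sigma)=\tau^n(\Sigma)$ for some integer $n\ge 1$. -/

import Mathlib

open CategoryTheory CategoryTheory.Limits AlgebraicGeometry MonoidalCategory
open scoped MonObj

universe u v

namespace AlgShift

/-! ### Groups -/

/-- `Γ` is polycyclic: it has a finite subnormal series from `1` to `Γ` with cyclic factors. -/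
def IsPolycyclic (Γ : Type v) [Group Γ] : Prop :=
  ∃ (n : ℕ) (H : ℕ → Subgroup Γ), H 0 = ⊥ ∧ H n = ⊤ ∧
    ∀ k < n, H k ≤ H (k + 1) ∧
      ∃ _ : ((H k).subgroupOf (H (k + 1))).Normal,
        IsCyclic (H (k + 1) ⧸ (H k).subgroupOf (H (k + 1)))

/-- `Γ` is polycyclic-by-finite: it has a polycyclic normal subgroup of finite index. -/
def IsPolycyclicByFinite (Γ : Type v) [Group Γ] : Prop :=
  ∃ N : Subgroup Γ, N.Normal ∧ N.FiniteIndex ∧ IsPolycyclic N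

/-! ### Algebraic groups and their rational points

An algebraic group over an algebraically closed field `K` is a group object `V` in the category of
schemes over `Spec K` whose structure morphism is of finite type (locally of finite type and
quasi-compact). It need not be affine, connected, or reduced. As usual it is identified with its
group of `K`-points when it serves as an alphabet. -/

section AlgebraicGroups

variable {K : Type u} [Field K]

/-- The set `V(K)` of `K`-points; it carries the group structure `Hom.group` when `V` is a group
object. -/
abbrev Points (V : Over (Spec (.of K))) : Type u :=
  𝟙_ (Over (Spec (.of K))) ⟶ V

/-- The power `V^I` as a scheme over `K`, for a finite index set `I`. -/
noncomputable abbrev power (V : Over (Spec (.of K))) (I : Type v) [Finite I] :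
    Over (Spec (.of K)) :=
  ∏ᶜ fun _ : I => V

/-- The identification `V(K)^I = V^I(K)`, and more generally `V(T)^I = V^I(T)`. -/
noncomputable abbrev tuple {V T : Over (Spec (.of K))} {I : Type v} [Finite I] (x : I → (T ⟶ V)) :
    T ⟶ power V I :=
  Pi.lift x

/-- The (closed) point of the underlying space of `V^I` given by a tuple of `K`-points of `V`. -/
noncomputable def pointOf {V : Over (Spec (.of K))} {I : Type v} [Finite I] (x : I → Points V) :
    (power V I).left :=
  (tuple x).left (IsLocalRing.closedPoint K)

/-- Zariski closed subsets of `V(K)^I = V^I(K)`: the traces of the closed subsets of the underlying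
space of the scheme `V^I`. -/
def IsZariskiClosed {V : Over (Spec (.of K))} {I : Type v} [Finite I] (W : Set (I → Points V)) :
    Prop :=
  ∃ C : Set (power V I).left, IsClosed C ∧ W = {x | pointOf x ∈ C}

/-- Algebraic subgroups of `V^I`, as sets of `K`-points: the Zariski closed subgroups. -/
def IsAlgebraicSubgroup {V : Over (Spec (.of K))} [GrpObj V] {I : Type v} [Finite I]
    (W : Set (I → Points V)) : Prop :=
  (∃ H : Subgroup (I → Points V), (H : Set (I → Points V)) = W) ∧ IsZariskiClosed W

/-- A morphism `U^I ⟶ V` of schemes over `K` is a homomorphism of algebraic groups: it is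
multiplicative on `T`-points for every scheme `T` over `K`. -/
def IsAlgebraicGroupHom {U V : Over (Spec (.of K))} [GrpObj U] [GrpObj V] {I : Type v} [Finite I]
    (f : power U I ⟶ V) : Prop :=
  ∀ (T : Over (Spec (.of K))) (x y : I → (T ⟶ U)),
    tuple (x * y) ≫ f = (tuple x ≫ f) * (tuple y ≫ f)

end AlgebraicGroups

/-! ### Shifts -/

section Shifts

variable {G : Type v} [Group G]

/-- The shift action `(g x)(h) = x (g⁻¹ h)` on configurations. -/
def shift {A : Type u} (g : G) (x : G → A) : G → A := fun h => x (g⁻¹ * h)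

/-- `G`-invariant sets of configurations. -/
def IsSubshift {A : Type u} (X : Set (G → A)) : Prop :=
  ∀ g : G, ∀ x ∈ X, shift g x ∈ X

/-- Closedness for the prodiscrete topology: the product of the discrete topologies. -/
def IsProdiscreteClosed {A : Type u} (X : Set (G → A)) : Prop :=
  @IsClosed (G → A) (@Pi.topologicalSpace G (fun _ => A) (fun _ => ⊥)) X

/-- The restriction `X_E` of a set of configurations to a finite set `E`. -/
def restrictSet {A : Type u} (X : Set (G → A)) (E : Finset G) : Set (E → A) :=
  (fun x => E.restrict x) '' X

/-- The subshift of finite type `Σ(A^G; D, P)`. -/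
def subshiftOfFiniteType {A : Type u} (D : Finset G) (P : Set (D → A)) : Set (G → A) :=
  {x | ∀ g : G, D.restrict (shift g⁻¹ x) ∈ P}

variable {K : Type u} [Field K] {U V : Over (Spec (.of K))} [GrpObj U] [GrpObj V]

/-- Algebraic group subshifts of `V^G`. -/
structure IsAlgebraicGroupSubshift (X : Set (G → Points V)) : Prop where
  isSubshift : IsSubshift X
  isClosed : IsProdiscreteClosed X
  isAlgebraicSubgroup : ∀ E : Finset G, IsAlgebraicSubgroup (restrictSet X E)

/-- Algebraic group subshifts of finite type of `V^G`. -/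
def IsAlgebraicGroupSubshiftOfFiniteType (X : Set (G → Points V)) : Prop :=
  ∃ (D : Finset G) (W : Set (D → Points V)),
    IsAlgebraicSubgroup W ∧ X = subshiftOfFiniteType D W

/-- Algebraic group cellular automata `U^G → V^G`: for some finite memory set `M`, the local
defining map `U^M → V` is (on `K`-points) a homomorphism of algebraic groups `f`. -/
def IsAlgebraicGroupCellularAutomaton (t : (G → Points U) → (G → Points V)) : Prop :=
  ∃ (M : Finset G) (f : power U M ⟶ V), IsAlgebraicGroupHom f ∧
    ∀ (x : G → Points U) (g : G), t x g = tuple (M.restrict (shift g⁻¹ x)) ≫ f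

/-- Algebraic group cellular automata `X → Y` between subshifts: the restrictions of algebraic group
cellular automata `U^G → V^G`. -/
def IsAlgebraicGroupCellularAutomatonOn {X : Set (G → Points U)} {Y : Set (G → Points V)}
    (τ : X → Y) : Prop :=
  ∃ t : (G → Points U) → (G → Points V), IsAlgebraicGroupCellularAutomaton t ∧
    ∀ x : X, (τ x : G → Points V) = t x

end Shifts

/-! ### Limit sets -/

/-- The limit set `Ω(f) = ⋂_{n ≥ 1} f^n(X)`. -/
def limitSet {X : Type*} (f : X → X) : Set X :=
  ⋂ n : ℕ, ⋂ _ : 1 ≤ n, Set.range f^[n]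

/-- `f` is stable: `f^{n+1}(X) = f^n(X)` for some `n ≥ 1`. -/
def IsStable {X : Type*} (f : X → X) : Prop :=
  ∃ n : ℕ, 1 ≤ n ∧ Set.range f^[n + 1] = Set.range f^[n]

end AlgShift

/-! The theorem reduces to a descending chain condition (`ShiftDCC`) for closed shift-invariant
subgroups of `V(K)^G`. Each image `τ^n(Σ)` is such a subgroup, so the decreasing sequence of images
is eventually constant, and its final value is the limit set. The same condition makes every such
subgroup of finite type (`exists_eq_subshiftOfFiniteType`): the finite type subshifts cut out by
larger and larger windows decrease to it.

Three facts about algebraic subgroups of finite powers of `V` are used: the descending chain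
condition, stability under intersection and inverse image, and stability under projection. The last
follows from Chevalley's theorem, since a constructible subgroup is closed. `ArtinianStructure`
records them, and the rest is pure group theory.

The chain condition replaces compactness: cosets of cylinder subgroups with the finite intersection
property have a common point (`sInter_nonempty_of_fip`). Hence projections of closed subgroups, also
to infinitely many coordinates, are closed, and so are images under cellular automata.

`ShiftDCC` climbs the polycyclic series as in Hilbert's basis theorem. For `G` generated by a normal
subgroup `N` and an element `a`, a shift on `G` is controlled by its `leading` groups, which are
shifts on `N`: the values on `N` of configurations trivial on `N a⁻ⁿ, …, N a⁻¹`. They play the role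
of ideals of leading coefficients. -/

namespace AlgShift

/-! ### Constructible subgroups are closed -/

section Topology

/-- A constructible subset of a Noetherian space is locally closed near a dense set of its
points. -/
theorem exists_isOpen_inter_closure_subset {X : Type*} [TopologicalSpace X]
    [TopologicalSpace.NoetherianSpace X] {S : Set X} (hS : Topology.IsConstructible S) :
    ∀ O : Set X, IsOpen O → (O ∩ S).Nonempty →
      ∃ U ⊆ O, IsOpen U ∧ (U ∩ S).Nonempty ∧ U ∩ closure S ⊆ S := by
  have : QuasiSeparatedSpace X :=
    ⟨fun U V _ _ _ _ => TopologicalSpace.NoetherianSpace.isCompact _⟩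
  refine Topology.IsConstructible.induction_of_isTopologicalBasis
    (P := fun S _ => ∀ O : Set X, IsOpen O → (O ∩ S).Nonempty →
      ∃ U ⊆ O, IsOpen U ∧ (U ∩ S).Nonempty ∧ U ∩ closure S ⊆ S)
    (fun U : TopologicalSpace.Opens X => (U : Set X)) ?_
    (fun U => TopologicalSpace.NoetherianSpace.isCompact _) ?_ ?_ S hS
  · have : Set.range (fun U : TopologicalSpace.Opens X => (U : Set X)) = {U | IsOpen U} := by
      ext U
      exact ⟨by rintro ⟨V, rfl⟩; exact V.2, fun h => ⟨⟨U, h⟩, rfl⟩⟩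
    rw [this]
    exact TopologicalSpace.isTopologicalBasis_opens
  · intro A s hs O hO hne
    have hZ : IsClosed (⋃ j ∈ s, (j : Set X))ᶜ :=
      (isOpen_biUnion fun j _ => j.isOpen).isClosed_compl
    refine ⟨O ∩ A, Set.inter_subset_left, hO.inter A.isOpen, ?_, ?_⟩
    · obtain ⟨x, hx, hx'⟩ := hne
      exact ⟨x, ⟨hx, hx'.1⟩, hx'⟩
    · rintro x ⟨⟨-, hxA⟩, hx⟩
      exact ⟨hxA, closure_minimal (fun y hy => hy.2) hZ hx⟩
  · intro S _ T _ ihS ihT O hO hne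
    wlog h : (O ∩ S).Nonempty generalizing S T
    · rw [Set.inter_union_distrib_left, Set.union_nonempty] at hne
      have hT := hne.resolve_left h
      rw [Set.union_comm S T]
      refine this T ‹_› S ‹_› ihT ihS ?_ hT
      rw [Set.inter_union_distrib_left]
      exact .inl hT
    obtain ⟨U, hUO, hU, hUS, hU'⟩ := ihS O hO h
    -- Either `T` is dense in `U ∩ S`, and shrinking `U` handles `T` as well, or removing `closure
    -- T` from `U` leaves only `S`.
    by_cases hc : U ∩ S ⊆ closure T
    · obtain ⟨x, hx⟩ := hUS
      obtain ⟨V, hVU, hV, hVT, hV'⟩ := ihT U hU (mem_closure_iff.1 (hc hx) U hU hx.1)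
      refine ⟨V, hVU.trans hUO, hV, hVT.mono (by gcongr; exact Set.subset_union_right), ?_⟩
      rw [closure_union]
      rintro y ⟨hy, hy' | hy'⟩
      · exact .inl (hU' ⟨hVU hy, hy'⟩)
      · exact .inr (hV' ⟨hy, hy'⟩)
    · obtain ⟨x, hx, hx'⟩ := Set.not_subset.1 hc
      refine ⟨U \ closure T, Set.sdiff_subset.trans hUO, hU.sdiff isClosed_closure,
        ⟨x, ⟨hx.1, hx'⟩, .inl hx.2⟩, ?_⟩
      rw [closure_union]
      rintro y ⟨hy, hy' | hy'⟩
      · exact .inl (hU' ⟨hy.1, hy'⟩)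
      · exact (hy.2 hy').elim

/-- A constructible subgroup of a Noetherian group with continuous translations and inversion is
closed. -/
theorem isClosed_of_isConstructible_subgroup {A : Type*} [Group A] [TopologicalSpace A]
    [TopologicalSpace.NoetherianSpace A] [SeparatelyContinuousMul A] [ContinuousInv A]
    (H : Subgroup A) (hH : Topology.IsConstructible (H : Set A)) : IsClosed (H : Set A) := by
  obtain ⟨U, -, hU, ⟨u, huU, huH⟩, hUH⟩ :=
    exists_isOpen_inter_closure_subset hH Set.univ isOpen_univ ⟨1, trivial, H.one_mem⟩
  refine isClosed_of_closure_subset fun g hg => ?_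
  have hmul : ∀ h ∈ H, h * g ∈ closure (H : Set A) := fun h hh =>
    map_mem_closure (continuous_const_mul h) hg fun x hx => H.mul_mem hh hx
  -- This open set contains `g`, so it meets `H` in some `x`. Then `u * x⁻¹ * g` lies in `U ∩
  -- closure H ⊆ H`, while `u * x⁻¹ ∈ H`.
  have hopen : IsOpen ((fun x : A => u * x⁻¹ * g) ⁻¹' U) :=
    hU.preimage (by
      have h1 : Continuous fun x : A => u * x⁻¹ := (continuous_const_mul u).comp continuous_inv
      exact (continuous_mul_const g).comp h1)
  obtain ⟨x, hx, hxH⟩ := mem_closure_iff.1 hg _ hopen (by simpa using huU)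
  have hxg := hUH ⟨hx, hmul _ (H.mul_mem huH (H.inv_mem hxH))⟩
  have := H.mul_mem (H.inv_mem (H.mul_mem huH (H.inv_mem hxH))) hxg
  simpa [mul_assoc] using this

end Topology

/-! ### Finite powers of a scheme of finite type -/

section Power

variable {K : Type u} [Field K]

theorem tuple_comp {V T T' : Over (Spec (.of K))} {I : Type v} [Finite I] (f : T' ⟶ T)
    (x : I → (T ⟶ V)) : f ≫ tuple x = tuple fun i => f ≫ x i := by
  refine Pi.hom_ext _ _ fun i => ?_
  simp [tuple]

theorem tuple_π {V T : Over (Spec (.of K))} {I : Type v} [Finite I] (x : I → (T ⟶ V)) (i : I) :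
    tuple x ≫ Pi.π (fun _ : I => V) i = x i := by
  simp [tuple]

theorem tuple_eta {V T : Over (Spec (.of K))} {I : Type v} [Finite I] (f : T ⟶ power V I) :
    (tuple fun i => f ≫ Pi.π (fun _ : I => V) i) = f := by
  refine Pi.hom_ext _ _ fun i => ?_
  simp [tuple]

/-- A scheme over `K` whose structure morphism is of finite type. -/
def IsFiniteType (V : Over (Spec (.of K))) : Prop :=
  LocallyOfFiniteType V.hom ∧ QuasiCompact V.hom

theorem IsFiniteType.of_iso {V W : Over (Spec (.of K))} (e : V ≅ W) (h : IsFiniteType V) :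
    IsFiniteType W := by
  obtain ⟨h1, h2⟩ := h
  have hW : W.hom = e.inv.left ≫ V.hom := (Over.w e.inv).symm
  have : IsIso e.inv.left := inferInstanceAs (IsIso ((Over.forget _).map e.inv))
  constructor <;> rw [hW]
  · exact inferInstanceAs (LocallyOfFiniteType (X := W.left) (Y := Spec (.of K))
      (CategoryStruct.comp (Y := V.left) e.inv.left V.hom))
  · exact inferInstanceAs (QuasiCompact (X := W.left) (Y := Spec (.of K))
      (CategoryStruct.comp (Y := V.left) e.inv.left V.hom))

theorem IsFiniteType.tensor {V W : Over (Spec (.of K))} (hV : IsFiniteType V)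
    (hW : IsFiniteType W) : IsFiniteType (V ⊗ W) := by
  obtain ⟨h1, h2⟩ := hV
  obtain ⟨h3, h4⟩ := hW
  constructor <;> rw [Over.tensorObj_hom] <;> infer_instance

theorem isFiniteType_unit : IsFiniteType (𝟙_ (Over (Spec (.of K)))) := by
  exact ⟨inferInstanceAs (LocallyOfFiniteType (𝟙 (Spec (.of K)))),
    inferInstanceAs (QuasiCompact (𝟙 (Spec (.of K))))⟩

open CartesianMonoidalCategory in
theorem IsFiniteType.finitePower {V : Over (Spec (.of K))} (hV : IsFiniteType V) (I : Type v)
    [Finite I] : IsFiniteType (power V I) := by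
  refine Finite.induction_empty_option
    (P := fun I => ∀ _ : Finite I, IsFiniteType (power V I)) ?_ ?_ ?_ I ‹_›
  · intro I J e h _
    have : Finite I := .of_equiv _ e.symm
    refine (h ‹_›).of_iso ⟨tuple fun i => Pi.π _ (e.symm i), tuple fun i => Pi.π _ (e i), ?_, ?_⟩ <;>
    · rw [tuple_comp]
      simp only [tuple_π]
      refine Pi.hom_ext _ _ fun i => ?_
      simp
  · intro _
    refine isFiniteType_unit.of_iso ⟨tuple fun i => i.elim, toUnit _, toUnit_unique _ _, ?_⟩
    exact Pi.hom_ext _ _ fun i => i.elim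
  · intro I _ h _
    refine (hV.tensor (h inferInstance)).of_iso ⟨tuple fun i => i.elim (fst _ _) fun j => snd _ _ ≫ Pi.π _ j,
      lift (Pi.π _ none) (tuple fun i => Pi.π _ (some i)), ?_, ?_⟩
    · refine CartesianMonoidalCategory.hom_ext _ _ ?_ ?_
      · simp
      · refine Pi.hom_ext _ _ fun i => ?_
        simp
    · refine Pi.hom_ext _ _ fun i => ?_
      cases i <;> simp

end Power

/-! ### The Zariski topology on `K`-points and Chevalley's theorem -/

section PointMap

variable {K : Type u} [Field K]

/-- The map on tuples of `K`-points induced by a morphism between powers of `V`. -/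
noncomputable def pointMap {V : Over (Spec (.of K))} {I J : Type v} [Finite I] [Finite J]
    (f : power V I ⟶ power V J) (x : I → Points V) : J → Points V :=
  fun j => (tuple x ≫ f) ≫ Pi.π (fun _ : J => V) j

theorem tuple_pointMap {V : Over (Spec (.of K))} {I J : Type v} [Finite I] [Finite J]
    (f : power V I ⟶ power V J) (x : I → Points V) : tuple (pointMap f x) = tuple x ≫ f :=
  tuple_eta _

theorem pointOf_pointMap {V : Over (Spec (.of K))} {I J : Type v} [Finite I] [Finite J]
    (f : power V I ⟶ power V J) (x : I → Points V) :
    pointOf (pointMap f x) = f.left (pointOf x) := by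
  rw [pointOf, tuple_pointMap]
  rfl

/-- The Zariski topology on `V(K)^I`. -/
@[reducible] noncomputable def zariskiTopology (V : Over (Spec (.of K))) (I : Type v) [Finite I] :
    TopologicalSpace (I → Points V) :=
  .induced pointOf inferInstance

attribute [local instance] zariskiTopology

theorem isZariskiClosed_iff {V : Over (Spec (.of K))} {I : Type v} [Finite I]
    {W : Set (I → Points V)} : IsZariskiClosed W ↔ IsClosed W := by
  rw [isClosed_induced_iff]
  exact exists_congr fun C => and_congr_right fun _ => eq_comm

theorem continuous_pointOf {V : Over (Spec (.of K))} {I : Type v} [Finite I] :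
    Continuous (pointOf : (I → Points V) → _) :=
  continuous_induced_dom

theorem continuous_pointMap {V : Over (Spec (.of K))} {I J : Type v} [Finite I] [Finite J]
    (f : power V I ⟶ power V J) : Continuous (pointMap f) := by
  refine continuous_induced_rng.2 ?_
  have : pointOf ∘ pointMap f = f.left ∘ pointOf := funext fun x => pointOf_pointMap f x
  rw [this]
  exact f.left.continuous.comp continuous_pointOf

theorem locallyOfFinitePresentation_of_isLocallyNoetherian {X Y : Scheme.{u}} (f : X ⟶ Y)
    [LocallyOfFiniteType f] [IsLocallyNoetherian Y] : LocallyOfFinitePresentation f where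
  finitePresentation_appLE {U} hU V hV e := by
    have := IsLocallyNoetherian.component_noetherian (X := Y) ⟨U, hU⟩
    exact RingHom.FinitePresentation.of_finiteType.1 (f.finiteType_appLE hU hV e)

theorem IsFiniteType.isNoetherian {V : Over (Spec (.of K))} (hV : IsFiniteType V) :
    IsNoetherian V.left := by
  obtain ⟨h1, h2⟩ := hV
  have h3 : IsLocallyNoetherian V.left :=
    LocallyOfFiniteType.isLocallyNoetherian (Y := Spec (.of K)) V.hom
  have h4 : CompactSpace V.left :=
    QuasiCompact.compactSpace_of_compactSpace (Y := Spec (.of K)) V.hom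
  exact { }

theorem IsFiniteType.noetherianSpace {V : Over (Spec (.of K))} (hV : IsFiniteType V) (I : Type v)
    [Finite I] : TopologicalSpace.NoetherianSpace (I → Points V) := by
  have := (hV.finitePower I).isNoetherian
  exact (Topology.IsInducing.mk rfl : Topology.IsInducing
    (pointOf : (I → Points V) → _)).noetherianSpace

variable [IsAlgClosed K]

/-- By the Nullstellensatz the `K`-points of a scheme of finite type over an algebraically closed
field are its closed points. This lemma and the next two make that identification for `V^I`. -/
theorem IsFiniteType.pointOf_injective {V : Over (Spec (.of K))} (hV : IsFiniteType V)
    {I : Type v} [Finite I] : Function.Injective (pointOf : (I → Points V) → _) := by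
  intro x y hxy
  have h1 := (hV.finitePower I).1
  have h2 : tuple x = tuple y := by
    refine Over.OverMorphism.ext ?_
    exact ext_of_apply_closedPoint_eq (power V I).hom (Over.w (tuple x)) (Over.w (tuple y)) hxy
  funext i
  rw [← tuple_π x i, h2, tuple_π]

theorem IsFiniteType.isClosed_pointOf {V : Over (Spec (.of K))} (hV : IsFiniteType V)
    {I : Type v} [Finite I] (x : I → Points V) : IsClosed {pointOf x} := by
  have h1 := (hV.finitePower I).1
  exact (pointEquivClosedPoint (power V I).hom ⟨(tuple x).left, Over.w (tuple x)⟩).2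

theorem IsFiniteType.exists_pointOf_eq {V : Over (Spec (.of K))} (hV : IsFiniteType V)
    {I : Type v} [Finite I] (c : (power V I).left) (hc : IsClosed {c}) :
    ∃ x : I → Points V, pointOf x = c := by
  have h1 := (hV.finitePower I).1
  let p : Points (power V I) := Over.homMk (pointOfClosedPoint (power V I).hom c hc)
    (pointOfClosedPoint_comp (power V I).hom c hc)
  refine ⟨fun i => p ≫ Pi.π _ i, ?_⟩
  rw [pointOf, tuple_eta]
  exact pointOfClosedPoint_apply _ c hc _

/-- Chevalley's theorem gives constructibility of the image in the scheme; the Jacobson property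
shows that passing to `K`-points loses nothing. -/
theorem IsFiniteType.isConstructible_image_pointMap {V : Over (Spec (.of K))}
    (hV : IsFiniteType V) {I J : Type v} [Finite I] [Finite J] (f : power V I ⟶ power V J)
    {W : Set (I → Points V)} (hW : IsClosed W) :
    Topology.IsConstructible (pointMap f '' W) := by
  obtain ⟨C, hC, rfl⟩ := isClosed_induced_iff.1 hW
  have := (hV.finitePower I).isNoetherian
  have := (hV.finitePower J).isNoetherian
  have hI := (hV.finitePower I).1
  have hJ := (hV.finitePower J).1
  have : LocallyOfFiniteType (f.left ≫ (power V J).hom) := by rwa [Over.w]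
  have : LocallyOfFiniteType f.left := locallyOfFiniteType_of_comp f.left (power V J).hom
  have := locallyOfFinitePresentation_of_isLocallyNoetherian f.left
  have : JacobsonSpace (power V I).left :=
    LocallyOfFiniteType.jacobsonSpace (Y := Spec (.of K)) (power V I).hom
  have hC' : Topology.IsConstructible C := by
    rw [← Topology.isConstructible_compl]
    exact (TopologicalSpace.NoetherianSpace.isCompact _).isConstructible hC.isOpen_compl
  have key : pointMap f '' (pointOf ⁻¹' C) = pointOf ⁻¹' (f.left '' C) := by
    ext y
    constructor
    · rintro ⟨x, hx, rfl⟩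
      exact ⟨pointOf x, hx, (pointOf_pointMap f x).symm⟩
    · rintro ⟨c, hc, hcy⟩
      -- The part of the fibre over `y` in `C` is closed and nonempty, so it contains a closed
      -- point, which is a `K`-point.
      have hZ : IsClosed (C ∩ f.left ⁻¹' {pointOf y}) :=
        hC.inter ((hV.isClosed_pointOf y).preimage f.left.continuous)
      obtain ⟨c', ⟨hc', hcy'⟩, hcl⟩ := nonempty_inter_closedPoints
        (Z := C ∩ f.left ⁻¹' {pointOf y}) ⟨c, hc, hcy⟩ hZ.isLocallyClosed
      obtain ⟨x, rfl⟩ := hV.exists_pointOf_eq c' hcl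
      exact ⟨x, hc', hV.pointOf_injective ((pointOf_pointMap f x).trans hcy')⟩
  have := hV.noetherianSpace I
  have := hV.noetherianSpace J
  rw [key]
  exact (f.left.isConstructible_image hC').preimage continuous_pointOf
    fun t _ _ => fun U _ _ => TopologicalSpace.NoetherianSpace.isCompact _
end PointMap

/-! ### Cylinders, linear compactness and closed subgroups -/

section Abstract

/-- Precomposition with `e`, as a homomorphism between groups of functions. -/
def reindex (A : Type u) [Group A] {S T : Type*} (e : T → S) : (S → A) →* (T → A) where
  toFun x := x ∘ e
  map_one' := rfl
  map_mul' _ _ := rfl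

@[simp]
theorem reindex_apply {A : Type u} [Group A] {S T : Type*} (e : T → S) (x : S → A) (t : T) :
    reindex A e x t = x (e t) := rfl

theorem reindex_surjective {A : Type u} [Group A] {S T : Type*} {e : T → S}
    (he : Function.Injective e) : Function.Surjective (reindex A e) :=
  fun y => ⟨Function.extend e y 1, funext fun t => he.extend_apply _ _ t⟩

/-- A family of subgroups of the finite powers of `A` that is stable under intersection and under
direct and inverse images along the change of index set, and satisfies the descending chain
condition. -/
structure ArtinianStructure (A : Type u) [Group A] where
  /-- The distinguished subgroups of a finite power of `A`. -/
  alg : ∀ (I : Type v) [Finite I], Set (Subgroup (I → A))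
  top_mem : ∀ (I : Type v) [Finite I], ⊤ ∈ alg I
  bot_mem : ∀ (I : Type v) [Finite I], ⊥ ∈ alg I
  inf_mem : ∀ {I : Type v} [Finite I] {W W' : Subgroup (I → A)},
    W ∈ alg I → W' ∈ alg I → W ⊓ W' ∈ alg I
  comap_mem : ∀ {I J : Type v} [Finite I] [Finite J] (e : J → I) {W : Subgroup (J → A)},
    W ∈ alg J → W.comap (reindex A e) ∈ alg I
  map_mem : ∀ {I J : Type v} [Finite I] [Finite J] (e : J → I) {W : Subgroup (I → A)},
    W ∈ alg I → W.map (reindex A e) ∈ alg J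
  wellFoundedLT : ∀ (I : Type v) [Finite I], WellFoundedLT (alg I)

variable {A : Type u} [Group A] (𝒜 : ArtinianStructure.{u, v} A) {S T : Type v}

namespace ArtinianStructure

/-- Cylinder subgroups of `A^S`: those defined by an algebraic condition on finitely many
coordinates. -/
def IsCylinder (N : Subgroup (S → A)) : Prop :=
  ∃ (I : Type v) (_ : Finite I) (e : I → S) (W : Subgroup (I → A)),
    W ∈ 𝒜.alg I ∧ N = W.comap (reindex A e)

variable {𝒜}

theorem isCylinder_comap {I : Type v} [Finite I] (e : I → S) {W : Subgroup (I → A)}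
    (hW : W ∈ 𝒜.alg I) : 𝒜.IsCylinder (W.comap (reindex A e)) :=
  ⟨I, ‹_›, e, W, hW, rfl⟩

theorem isCylinder_top : 𝒜.IsCylinder (⊤ : Subgroup (S → A)) :=
  ⟨PEmpty, inferInstance, PEmpty.elim, ⊤, 𝒜.top_mem _, rfl⟩

theorem IsCylinder.inf {N N' : Subgroup (S → A)} (hN : 𝒜.IsCylinder N) (hN' : 𝒜.IsCylinder N') :
    𝒜.IsCylinder (N ⊓ N') := by
  obtain ⟨I, _, e, W, hW, rfl⟩ := hN
  obtain ⟨J, _, f, W', hW', rfl⟩ := hN'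
  exact ⟨I ⊕ J, inferInstance, Sum.elim e f,
    W.comap (reindex A Sum.inl) ⊓ W'.comap (reindex A Sum.inr),
    𝒜.inf_mem (𝒜.comap_mem _ hW) (𝒜.comap_mem _ hW'), rfl⟩

theorem IsCylinder.comap {N : Subgroup (T → A)} (hN : 𝒜.IsCylinder N) (f : T → S) :
    𝒜.IsCylinder (N.comap (reindex A f)) := by
  obtain ⟨I, _, e, W, hW, rfl⟩ := hN
  exact ⟨I, inferInstance, f ∘ e, W, hW, rfl⟩

/-- Only the finite set `E` of coordinates in the ranges of `e` and `f` matters. Restriction to `E`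
is surjective, so the image can be computed inside `A^E`. -/
theorem IsCylinder.map_mem {N : Subgroup (S → A)} (hN : 𝒜.IsCylinder N) {F : Type v} [Finite F]
    (f : F → S) : N.map (reindex A f) ∈ 𝒜.alg F := by
  obtain ⟨I, _, e, W, hW, rfl⟩ := hN
  let E : Set S := Set.range e ∪ Set.range f
  have : Finite E := ((Set.finite_range e).union (Set.finite_range f)).to_subtype
  let e' : I → E := fun i => ⟨e i, .inl ⟨i, rfl⟩⟩
  let f' : F → E := fun i => ⟨f i, .inr ⟨i, rfl⟩⟩
  have h1 : W.comap (reindex A e) =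
      (W.comap (reindex A e')).comap (reindex A (Subtype.val : E → S)) := rfl
  have h2 : reindex A f = (reindex A f').comp (reindex A (Subtype.val : E → S)) := rfl
  rw [h1, h2, ← Subgroup.map_map, Subgroup.map_comap_eq_self_of_surjective
    (reindex_surjective Subtype.val_injective)]
  exact 𝒜.map_mem _ (𝒜.comap_mem _ hW)

variable (𝒜) in
/-- Left cosets of cylinder subgroups. -/
def IsCylinderCoset (C : Set (S → A)) : Prop :=
  ∃ (a : S → A) (N : Subgroup (S → A)), 𝒜.IsCylinder N ∧ C = {x | a⁻¹ * x ∈ N}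

theorem setOf_inv_mul_mem_congr {B : Type*} [Group B] {N : Subgroup B} {a b : B}
    (h : a⁻¹ * b ∈ N) : {x | a⁻¹ * x ∈ N} = {x | b⁻¹ * x ∈ N} := by
  ext x
  have : a⁻¹ * x = (a⁻¹ * b) * (b⁻¹ * x) := by group
  simp only [Set.mem_ofPred_eq]
  rw [this]
  exact N.mul_mem_cancel_left h

theorem IsCylinderCoset.inter {C D : Set (S → A)} (hC : 𝒜.IsCylinderCoset C)
    (hD : 𝒜.IsCylinderCoset D) (hne : (C ∩ D).Nonempty) : 𝒜.IsCylinderCoset (C ∩ D) := by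
  obtain ⟨a, N, hN, rfl⟩ := hC
  obtain ⟨b, N', hN', rfl⟩ := hD
  obtain ⟨c, hc, hc'⟩ := hne
  refine ⟨c, N ⊓ N', hN.inf hN', ?_⟩
  rw [setOf_inv_mul_mem_congr hc, setOf_inv_mul_mem_congr hc']
  rfl

theorem isCylinderCoset_univ : 𝒜.IsCylinderCoset (Set.univ : Set (S → A)) :=
  ⟨1, ⊤, isCylinder_top, by simp⟩

theorem isCylinderCoset_sInter {t : Set (Set (S → A))} (ht : t.Finite)
    (h : ∀ C ∈ t, 𝒜.IsCylinderCoset C) (hne : (⋂₀ t).Nonempty) :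
    𝒜.IsCylinderCoset (⋂₀ t) := by
  induction t, ht using Set.Finite.induction_on with
  | empty => simpa using isCylinderCoset_univ
  | insert _ _ ih =>
    rw [Set.sInter_insert] at hne ⊢
    exact (h _ (Set.mem_insert _ _)).inter
      (ih (fun C hC => h C (Set.mem_insert_of_mem _ hC)) (hne.mono Set.inter_subset_right)) hne

/-- The finite intersection property. -/
def FIP {B : Type*} (𝓕 : Set (Set B)) : Prop := ∀ t ⊆ 𝓕, t.Finite → (⋂₀ t).Nonempty

theorem exists_maximal_fip {𝓕 : Set (Set (S → A))} (h : ∀ C ∈ 𝓕, 𝒜.IsCylinderCoset C)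
    (hF : FIP 𝓕) : ∃ 𝓜, 𝓕 ⊆ 𝓜 ∧ Maximal (fun 𝓖 : Set (Set (S → A)) =>
      (∀ C ∈ 𝓖, 𝒜.IsCylinderCoset C) ∧ FIP 𝓖) 𝓜 := by
  refine zorn_subset_nonempty {𝓖 : Set (Set (S → A)) | (∀ C ∈ 𝓖, 𝒜.IsCylinderCoset C) ∧ FIP 𝓖}
    ?_ 𝓕 ⟨h, hF⟩
  intro c hc hchain hne
  refine ⟨⋃₀ c, ⟨?_, ?_⟩, fun s hs => Set.subset_sUnion_of_mem hs⟩
  · rintro C ⟨𝓖, h𝓖, hC⟩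
    exact (hc h𝓖).1 C hC
  · intro t ht htf
    obtain ⟨𝓖, h𝓖, ht𝓖⟩ := hchain.directedOn.exists_mem_subset_of_finite_of_subset_sUnion
      hne htf ht
    exact (hc h𝓖).2 t ht𝓖 htf

section Maximal

variable {𝓜 : Set (Set (S → A))}

/-- Maximal families play the role of ultrafilters: a coset compatible with all finite intersections
already belongs to the family. -/
theorem mem_of_maximal_fip (hM : Maximal (fun 𝓖 : Set (Set (S → A)) =>
      (∀ C ∈ 𝓖, 𝒜.IsCylinderCoset C) ∧ FIP 𝓖) 𝓜) {C : Set (S → A)} (hC : 𝒜.IsCylinderCoset C)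
    (h : ∀ t ⊆ 𝓜, t.Finite → (C ∩ ⋂₀ t).Nonempty) : C ∈ 𝓜 := by
  refine hM.2 (y := insert C 𝓜) ⟨?_, ?_⟩ (Set.subset_insert _ _) (Set.mem_insert _ _)
  · rintro D (rfl | hD)
    exacts [hC, hM.1.1 D hD]
  · intro t ht htf
    refine (h (t \ {C}) ?_ htf.sdiff).mono ?_
    · intro D hD
      exact (ht hD.1).resolve_left hD.2
    · intro x hx D hD
      by_cases hDC : D = C
      · exact hDC ▸ hx.1
      · exact hx.2 D ⟨hD, hDC⟩

theorem mem_of_maximal_fip_of_superset (hM : Maximal (fun 𝓖 : Set (Set (S → A)) =>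
      (∀ C ∈ 𝓖, 𝒜.IsCylinderCoset C) ∧ FIP 𝓖) 𝓜) {C : Set (S → A)} (hC : 𝒜.IsCylinderCoset C)
    {t : Set (Set (S → A))} (ht : t ⊆ 𝓜) (htf : t.Finite) (htC : ⋂₀ t ⊆ C) : C ∈ 𝓜 := by
  refine mem_of_maximal_fip hM hC fun t' ht' htf' => ?_
  refine (hM.1.2 (t ∪ t') (Set.union_subset ht ht') (htf.union htf')).mono ?_
  rw [Set.sInter_union]
  exact Set.inter_subset_inter_left _ htC

/-- Among the cosets of algebraic subgroups of `A` that the family imposes on coordinate `s`, take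
one, `aP`, with `P` minimal. By minimality it lies in the projection of every finite intersection
from the family, so any of its elements can be prescribed at `s`. -/
theorem exists_setOf_eq_mem_of_maximal_fip (hM : Maximal (fun 𝓖 : Set (Set (S → A)) =>
      (∀ C ∈ 𝓖, 𝒜.IsCylinderCoset C) ∧ FIP 𝓖) 𝓜) (s : S) :
    ∃ a : A, {x : S → A | x s = a} ∈ 𝓜 := by
  let f : PUnit.{v + 1} → S := fun _ => s
  let Q : Set (𝒜.alg PUnit.{v + 1}) :=
    {P | ∃ a : S → A, {x | a⁻¹ * x ∈ P.1.comap (reindex A f)} ∈ 𝓜}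
  have hQ : Q.Nonempty := ⟨⟨⊤, 𝒜.top_mem _⟩, 1, by
    refine mem_of_maximal_fip_of_superset hM ⟨1, _, isCylinder_comap f (𝒜.top_mem _), rfl⟩
      (Set.empty_subset _) Set.finite_empty ?_
    simp⟩
  obtain ⟨P, ⟨a, ha⟩, hmin⟩ := (𝒜.wellFoundedLT PUnit.{v + 1}).wf.has_min Q hQ
  have hsing : {x : S → A | x s = a s} =
      {x | a⁻¹ * x ∈ (⊥ : Subgroup (PUnit.{v + 1} → A)).comap (reindex A f)} := by
    ext x
    simp only [Set.mem_ofPred_eq, Subgroup.mem_comap, Subgroup.mem_bot]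
    constructor
    · intro h
      funext i
      simp [f, h]
    · intro h
      have := congrFun h PUnit.unit
      simpa [f, inv_mul_eq_one, eq_comm] using this
  refine ⟨a s, mem_of_maximal_fip hM ⟨a, _, isCylinder_comap f (𝒜.bot_mem _), hsing⟩ ?_⟩
  intro t ht htf
  obtain ⟨b, N, hN, hb⟩ := isCylinderCoset_sInter htf (fun C hC => hM.1.1 C (ht hC))
    (hM.1.2 t ht htf)
  let P' := N.map (reindex A f)
  have hP' : P' ∈ 𝒜.alg _ := hN.map_mem f
  have hC' : {x | b⁻¹ * x ∈ P'.comap (reindex A f)} ∈ 𝓜 := by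
    refine mem_of_maximal_fip_of_superset hM ⟨b, _, isCylinder_comap f hP', rfl⟩ ht htf ?_
    rw [hb]
    exact fun x hx => Subgroup.mem_map_of_mem _ hx
  have hpair : ({{x | a⁻¹ * x ∈ P.1.comap (reindex A f)},
      {x | b⁻¹ * x ∈ P'.comap (reindex A f)}} : Set (Set (S → A))) ⊆ 𝓜 := by
    rintro _ (rfl | rfl)
    exacts [ha, hC']
  obtain ⟨c, hc⟩ := hM.1.2 _ hpair (by simp)
  rw [Set.sInter_pair] at hc
  have hinf : (⟨P.1 ⊓ P', 𝒜.inf_mem P.2 hP'⟩ : 𝒜.alg PUnit.{v + 1}) ∈ Q := by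
    refine ⟨c, mem_of_maximal_fip_of_superset hM
      ⟨c, _, isCylinder_comap f (𝒜.inf_mem P.2 hP'), rfl⟩ hpair (by simp) ?_⟩
    rw [Set.sInter_pair, setOf_inv_mul_mem_congr (N := P.1.comap (reindex A f)) hc.1,
      setOf_inv_mul_mem_congr (N := P'.comap (reindex A f)) hc.2]
    exact fun x hx => hx
  -- Otherwise `P ⊓ P'` would be a strictly smaller member of `Q`. Hence the coset of `P` lies
  -- inside the projection of `⋂₀ t`.
  have hle : P.1 ≤ P' := by
    by_contra hcon
    refine hmin _ hinf (lt_of_le_of_ne (show P.1 ⊓ P' ≤ P.1 from inf_le_left) fun h => hcon ?_)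
    exact inf_eq_left.1 (congrArg Subtype.val h)
  have ha' : a ∈ {x | b⁻¹ * x ∈ P'.comap (reindex A f)} := by
    rw [setOf_inv_mul_mem_congr (N := P'.comap (reindex A f)) hc.2]
    refine hle (?_ : a ∈ {x | c⁻¹ * x ∈ P.1.comap (reindex A f)})
    rw [← setOf_inv_mul_mem_congr (N := P.1.comap (reindex A f)) hc.1]
    simp [P.1.one_mem]
  obtain ⟨z, hz, hza⟩ := ha'
  refine ⟨b * z, ?_, ?_⟩
  · have : z s = b⁻¹ s * a s := congrFun hza PUnit.unit
    simp [this]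
  · rw [hb]
    simpa using hz

end Maximal

/-- Cosets of cylinder subgroups with the finite intersection property have a common point. -/
theorem sInter_nonempty_of_fip {𝓕 : Set (Set (S → A))} (h : ∀ C ∈ 𝓕, 𝒜.IsCylinderCoset C)
    (hF : FIP 𝓕) : (⋂₀ 𝓕).Nonempty := by
  obtain ⟨𝓜, hFM, hM⟩ := exists_maximal_fip h hF
  choose x hx using exists_setOf_eq_mem_of_maximal_fip hM
  refine ⟨x, fun C hC => ?_⟩
  obtain ⟨a, N, ⟨I, _, e, W, hW, rfl⟩, rfl⟩ := h C hC
  -- Membership in `C` involves only the coordinates `e i`, and finitely many members of `𝓜` force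
  -- `z` to agree with `x` there.
  obtain ⟨z, hz⟩ := hM.1.2 (insert {y | a⁻¹ * y ∈ W.comap (reindex A e)}
    (Set.range fun i => {y : S → A | y (e i) = x (e i)}))
    (by
      rintro _ (rfl | ⟨i, rfl⟩)
      exacts [hFM hC, hx _]) ((Set.finite_range _).insert _)
  have h1 : reindex A e (a⁻¹ * z) ∈ W := hz _ (Set.mem_insert _ _)
  have h2 : reindex A e (a⁻¹ * x) = reindex A e (a⁻¹ * z) := by
    funext i
    have : z (e i) = x (e i) := hz _ (Set.mem_insert_of_mem _ ⟨i, rfl⟩)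
    simp [this]
  change reindex A e (a⁻¹ * x) ∈ W
  rwa [h2]

variable (𝒜) in
/-- Subgroups of `A^S` that are intersections of cylinder subgroups. -/
def IsClosedSubgroup (X : Subgroup (S → A)) : Prop :=
  ∀ x, (∀ N, 𝒜.IsCylinder N → X ≤ N → x ∈ N) → x ∈ X

theorem IsCylinder.isClosedSubgroup {N : Subgroup (S → A)} (hN : 𝒜.IsCylinder N) :
    𝒜.IsClosedSubgroup N :=
  fun _ hx => hx N hN le_rfl

theorem IsClosedSubgroup.inf {X Y : Subgroup (S → A)} (hX : 𝒜.IsClosedSubgroup X)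
    (hY : 𝒜.IsClosedSubgroup Y) : 𝒜.IsClosedSubgroup (X ⊓ Y) :=
  fun x hx => ⟨hX x fun N hN h => hx N hN (inf_le_left.trans h),
    hY x fun N hN h => hx N hN (inf_le_right.trans h)⟩

theorem IsClosedSubgroup.iInf {J : Sort*} {X : J → Subgroup (S → A)}
    (hX : ∀ i, 𝒜.IsClosedSubgroup (X i)) : 𝒜.IsClosedSubgroup (⨅ i, X i) :=
  fun x hx => Subgroup.mem_iInf.2 fun i =>
    hX i x fun N hN h => hx N hN ((iInf_le X i).trans h)

theorem IsClosedSubgroup.comap {X : Subgroup (T → A)} (hX : 𝒜.IsClosedSubgroup X) (f : T → S) :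
    𝒜.IsClosedSubgroup (X.comap (reindex A f)) :=
  fun _ hx => hX _ fun _ hN h => hx _ (hN.comap f) (Subgroup.comap_mono h)

/-- A preimage of `y` in `X` is a common point of the sets `cond N F`, for `N` a cylinder containing
`X` and `F` a finite set on which to match `y`. These are cosets of cylinders, nonempty because `y`
satisfies every cylinder condition valid on the image, and directed downwards. -/
theorem IsClosedSubgroup.map {X : Subgroup (S → A)} (hX : 𝒜.IsClosedSubgroup X) (f : T → S) :
    𝒜.IsClosedSubgroup (X.map (reindex A f)) := by
  classical
  intro y hy
  let cond : Subgroup (S → A) → Finset T → Set (S → A) :=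
    fun N F => {x | x ∈ N ∧ ∀ t ∈ F, x (f t) = y t}
  let 𝓕 : Set (Set (S → A)) := {C | ∃ N F, 𝒜.IsCylinder N ∧ X ≤ N ∧ C = cond N F}
  have hne : ∀ N F, 𝒜.IsCylinder N → X ≤ N → (cond N F).Nonempty := by
    intro N F hN hXN
    have := hy _ ((isCylinder_comap (Subtype.val : F → T)
      (hN.map_mem (f ∘ (Subtype.val : F → T))))) (by
        rintro _ ⟨x, hx, rfl⟩
        exact ⟨x, hXN hx, rfl⟩)
    obtain ⟨z, hz, hzy⟩ := this
    exact ⟨z, hz, fun t ht => congrFun hzy ⟨t, ht⟩⟩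
  have hcos : ∀ C ∈ 𝓕, 𝒜.IsCylinderCoset C := by
    rintro _ ⟨N, F, hN, hXN, rfl⟩
    obtain ⟨z, hz, hzF⟩ := hne N F hN hXN
    refine ⟨z, _, hN.inf (isCylinder_comap (f ∘ (Subtype.val : F → T)) (𝒜.bot_mem _)), ?_⟩
    ext x
    simp only [cond, Set.mem_ofPred_eq, Subgroup.mem_inf, Subgroup.mem_comap, Subgroup.mem_bot]
    refine and_congr (N.mul_mem_cancel_left (N.inv_mem hz)).symm ⟨fun h => ?_, fun h t ht => ?_⟩
    · funext t
      simp [h t t.2, hzF t t.2]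
    · have := congrFun h ⟨t, ht⟩
      rw [← hzF t ht]
      simpa [inv_mul_eq_one, eq_comm] using this
  have hfip : FIP 𝓕 := by
    intro t ht htf
    suffices ∃ C ∈ 𝓕, C ⊆ ⋂₀ t by
      obtain ⟨_, ⟨N, F, hN, hXN, rfl⟩, hC⟩ := this
      exact (hne N F hN hXN).mono hC
    induction t, htf using Set.Finite.induction_on with
    | empty => exact ⟨_, ⟨⊤, ∅, isCylinder_top, le_top, rfl⟩, by simp⟩
    | insert _ _ ih =>
      obtain ⟨_, ⟨N, F, hN, hXN, rfl⟩, hC⟩ := ih fun C hC => ht (Set.mem_insert_of_mem _ hC)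
      obtain ⟨N', F', hN', hXN', rfl⟩ := ht (Set.mem_insert _ _)
      refine ⟨_, ⟨N' ⊓ N, F' ∪ F, hN'.inf hN, le_inf hXN' hXN, rfl⟩, ?_⟩
      rw [Set.sInter_insert]
      exact fun x hx => ⟨⟨hx.1.1, fun t ht => hx.2 t (Finset.mem_union_left _ ht)⟩,
        hC ⟨hx.1.2, fun t ht => hx.2 t (Finset.mem_union_right _ ht)⟩⟩
  obtain ⟨x, hx⟩ := sInter_nonempty_of_fip hcos hfip
  refine ⟨x, hX x fun N hN hXN => (hx _ ⟨N, ∅, hN, hXN, rfl⟩).1, funext fun t => ?_⟩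
  exact (hx _ ⟨⊤, {t}, isCylinder_top, le_top, rfl⟩).2 t (Finset.mem_singleton_self t)

/-- A closed subgroup of a finite power is algebraic. -/
theorem IsClosedSubgroup.mem_alg {I : Type v} [Finite I] {X : Subgroup (I → A)}
    (hX : 𝒜.IsClosedSubgroup X) : X ∈ 𝒜.alg I := by
  obtain ⟨P, hP, hmin⟩ := (𝒜.wellFoundedLT I).wf.has_min {P | X ≤ P.1} 
    ⟨⟨⊤, 𝒜.top_mem I⟩, show X ≤ ⊤ from le_top⟩
  have : X = P.1 := by
    refine le_antisymm hP fun x hx => hX x fun N hN hXN => ?_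
    have hN' : N ∈ 𝒜.alg I := by
      have := hN.map_mem id
      rwa [show reindex A id = MonoidHom.id (I → A) from rfl, Subgroup.map_id] at this
    by_contra hcon
    refine hmin ⟨P.1 ⊓ N, 𝒜.inf_mem P.2 hN'⟩ (le_inf hP hXN)
      (lt_of_le_of_ne (show P.1 ⊓ N ≤ P.1 from inf_le_left) fun h => hcon ?_)
    exact inf_eq_left.1 (congrArg Subtype.val h) hx
  exact this ▸ P.2

/-- A closed subgroup is determined by its restrictions to finite sets. -/
theorem IsClosedSubgroup.mem_of_forall_finset {X : Subgroup (S → A)}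
    (hX : 𝒜.IsClosedSubgroup X) {x : S → A}
    (h : ∀ E : Finset S, ∃ y ∈ X, ∀ s ∈ E, y s = x s) : x ∈ X := by
  classical
  refine hX x ?_
  rintro _ ⟨I, _, e, W, hW, rfl⟩ hXN
  have := Fintype.ofFinite I
  obtain ⟨y, hy, hyx⟩ := h (Finset.univ.image e)
  have h1 : reindex A e y ∈ W := hXN hy
  have h2 : reindex A e x = reindex A e y :=
    funext fun i => (hyx _ (Finset.mem_image_of_mem e (Finset.mem_univ i))).symm
  change reindex A e x ∈ W
  rwa [h2]

end ArtinianStructure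

end Abstract

/-! ### The descending chain condition over polycyclic-by-finite groups -/

section GroupShifts

theorem wellFoundedLT_iff_antitone_chain_condition {α : Type*} [PartialOrder α] :
    WellFoundedLT α ↔ ∀ f : ℕ → α, Antitone f → ∃ n, ∀ m, n ≤ m → f n = f m := by
  refine ⟨fun _ f hf => WellFoundedLT.antitone_chain_condition hf, fun h => ?_⟩
  rw [← wellFoundedGT_dual_iff, wellFoundedGT_iff_monotone_chain_condition]
  exact fun a => h (OrderDual.ofDual ∘ a) a.monotone

variable {A : Type u} [Group A] (𝒜 : ArtinianStructure.{u, v} A) {G N : Type v} [Group G] [Group N]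

namespace ArtinianStructure

/-- Closed shift-invariant subgroups of `A^G`. -/
structure IsGroupShift (X : Subgroup (G → A)) : Prop where
  isClosedSubgroup : 𝒜.IsClosedSubgroup X
  isSubshift : IsSubshift (X : Set (G → A))

variable (G) in
/-- The descending chain condition for closed shift-invariant subgroups of `A^G`. -/
def ShiftDCC : Prop := WellFoundedLT {X : Subgroup (G → A) // 𝒜.IsGroupShift X}

variable {𝒜}

theorem shiftDCC_iff : 𝒜.ShiftDCC G ↔ ∀ X : ℕ → Subgroup (G → A), Antitone X →
    (∀ n, 𝒜.IsGroupShift (X n)) → ∃ n, ∀ m, n ≤ m → X n = X m := by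
  rw [ShiftDCC, wellFoundedLT_iff_antitone_chain_condition]
  constructor
  · intro h X hX hS
    obtain ⟨n, hn⟩ := h (fun n => ⟨X n, hS n⟩) hX
    exact ⟨n, fun m hm => congrArg Subtype.val (hn m hm)⟩
  · intro h X hX
    obtain ⟨n, hn⟩ := h (fun n => (X n).1) hX fun n => (X n).2
    exact ⟨n, fun m hm => Subtype.ext (hn m hm)⟩

theorem shiftDCC_of_finite [Finite G] : 𝒜.ShiftDCC G := by
  have := 𝒜.wellFoundedLT G
  rw [shiftDCC_iff]
  intro X hX hS
  obtain ⟨n, hn⟩ := WellFoundedLT.antitone_chain_condition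
    (f := fun n => (⟨X n, (hS n).isClosedSubgroup.mem_alg⟩ : 𝒜.alg G)) hX
  exact ⟨n, fun m hm => congrArg Subtype.val (hn m hm)⟩

/-- The subgroup of configurations in `X` that are trivial on `φ(N) T`. -/
def vanishing (φ : N →* G) (X : Subgroup (G → A)) (T : Set G) : Subgroup (G → A) :=
  X ⊓ ⨅ p : N × T, (⊥ : Subgroup (PUnit.{v + 1} → A)).comap
    (reindex A fun _ => φ p.1 * p.2)

theorem mem_vanishing {φ : N →* G} {X : Subgroup (G → A)} {T : Set G} {x : G → A} :
    x ∈ vanishing φ X T ↔ x ∈ X ∧ ∀ k, ∀ t ∈ T, x (φ k * t) = 1 := by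
  simp only [vanishing, Subgroup.mem_inf, Subgroup.mem_iInf, Subgroup.mem_comap,
    Subgroup.mem_bot, funext_iff]
  exact and_congr_right fun _ => ⟨fun h k t ht => h (k, ⟨t, ht⟩) PUnit.unit,
    fun h p _ => h p.1 p.2 p.2.2⟩

/-- The values on the coset `φ(N) s` of the configurations in `X` that are trivial on `φ(N) T`. -/
def leading (φ : N →* G) (X : Subgroup (G → A)) (T : Set G) (s : G) : Subgroup (N → A) :=
  (vanishing φ X T).map (reindex A fun k => φ k * s)

theorem mem_leading {φ : N →* G} {X : Subgroup (G → A)} {T : Set G} {s : G} {y : N → A} :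
    y ∈ leading φ X T s ↔
      ∃ x ∈ X, (∀ k, ∀ t ∈ T, x (φ k * t) = 1) ∧ ∀ k, x (φ k * s) = y k := by
  simp only [leading, Subgroup.mem_map, mem_vanishing, and_assoc]
  exact exists_congr fun x => and_congr_right fun _ => and_congr_right fun _ => funext_iff

theorem leading_mono {φ : N →* G} {X Y : Subgroup (G → A)} (h : X ≤ Y) {T T' : Set G}
    (hT : T' ⊆ T) (s : G) : leading φ X T s ≤ leading φ Y T' s := by
  intro y hy
  obtain ⟨x, hx, hx1, hxy⟩ := mem_leading.1 hy
  exact mem_leading.2 ⟨x, h hx, fun k t ht => hx1 k t (hT ht), hxy⟩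

theorem IsGroupShift.leading {X : Subgroup (G → A)} (hX : 𝒜.IsGroupShift X) (φ : N →* G)
    (T : Set G) (s : G) : 𝒜.IsGroupShift (leading φ X T s) where
  isClosedSubgroup := (hX.isClosedSubgroup.inf (.iInf fun _ =>
    (isCylinder_comap _ (𝒜.bot_mem _)).isClosedSubgroup)).map _
  isSubshift := by
    intro g y hy
    obtain ⟨x, hx, hx1, hxy⟩ := mem_leading.1 hy
    refine mem_leading.2 ⟨shift (φ g) x, hX.isSubshift _ x hx, fun k t ht => ?_, fun k => ?_⟩
    · simpa [shift, mul_assoc] using hx1 (g⁻¹ * k) t ht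
    · simpa [shift, mul_assoc] using hxy (g⁻¹ * k)

/-- Every configuration in `X` coincides on `φ(N) T` with one in `Y`. -/
def AgreeOn (φ : N →* G) (X Y : Subgroup (G → A)) (T : Set G) : Prop :=
  ∀ x ∈ X, ∃ y ∈ Y, ∀ k, ∀ t ∈ T, y (φ k * t) = x (φ k * t)

/-- If `y` matches `x` on `φ(N) T`, the error `x * y⁻¹` is trivial there. The hypothesis on leading
groups gives `w ∈ Y`, trivial there too, with the same values as the error on `φ(N) s`; then `w * y`
is the better approximation. -/
theorem AgreeOn.insert {φ : N →* G} {X Y : Subgroup (G → A)} (hYX : Y ≤ X) {T : Set G} {s : G}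
    (h : AgreeOn φ X Y T) (hs : ArtinianStructure.leading φ X T s ≤ leading φ Y T s) :
    AgreeOn φ X Y (insert s T) := by
  intro x hx
  obtain ⟨y, hy, hyx⟩ := h x hx
  have hmem : reindex A (fun k => φ k * s) (x * y⁻¹) ∈ ArtinianStructure.leading φ X T s :=
    mem_leading.2 ⟨x * y⁻¹, X.mul_mem hx (X.inv_mem (hYX hy)),
      fun k t ht => by simp [hyx k t ht], fun k => rfl⟩
  obtain ⟨w, hw, hw1, hws⟩ := mem_leading.1 (hs hmem)
  refine ⟨w * y, Y.mul_mem hw hy, fun k t ht => ?_⟩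
  rcases ht with rfl | ht
  · simp [hws]
  · simp [hw1 k t ht, hyx k t ht]

theorem IsClosedSubgroup.le_of_agreeOn {φ : N →* G} {X Y : Subgroup (G → A)}
    (hY : 𝒜.IsClosedSubgroup Y) {T : ℕ → Set G} (hT : Monotone T)
    (hcover : ∀ g, ∃ n, ∃ k, ∃ t ∈ T n, φ k * t = g) (h : ∀ n, AgreeOn φ X Y (T n)) : X ≤ Y := by
  intro x hx
  refine hY.mem_of_forall_finset fun E => ?_
  choose n k t ht hg using hcover
  obtain ⟨y, hy, hyx⟩ := h (E.sup n) x hx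
  refine ⟨y, hy, fun s hs => ?_⟩
  have := hyx (k s) (t s) (hT (Finset.le_sup hs) (ht s))
  rwa [hg] at this

/-- The cosets are added one at a time, each waiting for one more sequence of leading groups to
stabilise. -/
theorem ShiftDCC.of_finite_cover {φ : N →* G} (hN : 𝒜.ShiftDCC N) (T : Finset G)
    (hT : ∀ g, ∃ k, ∃ t ∈ T, φ k * t = g) : 𝒜.ShiftDCC G := by
  classical
  rw [shiftDCC_iff] at hN ⊢
  intro X hX hS
  have key : ∀ T : Finset G, ∃ n, ∀ m, n ≤ m → AgreeOn φ (X n) (X m) T := by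
    intro T
    induction T using Finset.induction_on with
    | empty => exact ⟨0, fun m _ x hx => ⟨1, (X m).one_mem, by simp⟩⟩
    | insert s T _ ih =>
      obtain ⟨n, hn⟩ := ih
      obtain ⟨n', hn'⟩ := hN (fun m => ArtinianStructure.leading φ (X m) T s)
        (fun i j hij => leading_mono (hX hij) subset_rfl s) fun m => (hS m).leading φ T s
      refine ⟨max n n', fun m hm => ?_⟩
      rw [Finset.coe_insert]
      refine AgreeOn.insert (hX hm) (fun x hx => ?_) ?_
      · exact hn m ((le_max_left _ _).trans hm) x (hX (le_max_left _ _) hx)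
      · exact ((hn' _ (le_max_right _ _)).symm.trans
          (hn' m ((le_max_right _ _).trans hm))).le
  obtain ⟨n, hn⟩ := key T
  refine ⟨n, fun m hm => le_antisymm ?_ (hX hm)⟩
  exact (hS m).isClosedSubgroup.le_of_agreeOn (T := fun _ => (T : Set G)) monotone_const
    (fun g => ⟨0, hT g⟩) fun _ => hn m hm

/-- The set `{a⁻ⁿ, …, a⁻¹}`. -/
def negPowers (a : G) (n : ℕ) : Set G := {g | ∃ i : ℕ, 1 ≤ i ∧ i ≤ n ∧ a ^ (-i : ℤ) = g}

theorem negPowers_mono (a : G) : Monotone (negPowers a) := by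
  rintro m n hmn _ ⟨i, h1, hi, rfl⟩
  exact ⟨i, h1, hi.trans hmn, rfl⟩

/-- Shifting by `a` carries the window `{a⁻ⁿ⁻¹, …, a⁻¹}` to `{a⁻ⁿ, …, a⁻¹, 1}`, so only the leading
groups at `1` are needed. Normality lets the cosets of `φ(N)` move along. -/
theorem agreeOn_negPowers {φ : N →* G} (hφ : φ.range.Normal) {X Y : Subgroup (G → A)}
    (hX : IsSubshift (X : Set (G → A))) (hY : IsSubshift (Y : Set (G → A))) (hYX : Y ≤ X) (a : G)
    (h : ∀ n, ArtinianStructure.leading φ X (negPowers a n) 1 ≤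
      ArtinianStructure.leading φ Y (negPowers a n) 1) (n : ℕ) :
    AgreeOn φ X Y (negPowers a n) := by
  induction n with
  | zero =>
    refine fun x _ => ⟨1, Y.one_mem, ?_⟩
    rintro k _ ⟨i, h1, h0, -⟩
    omega
  | succ n ih =>
    intro x hx
    obtain ⟨y, hy, hyx⟩ := ih.insert hYX (h n) (shift a x) (hX a x hx)
    refine ⟨shift a⁻¹ y, hY _ y hy, ?_⟩
    rintro k _ ⟨i, h1, hi, rfl⟩
    obtain ⟨k', hk'⟩ : a * φ k * a⁻¹ ∈ φ.range := hφ.conj_mem _ ⟨k, rfl⟩ a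
    have hmem : a * a ^ (-i : ℤ) ∈ insert 1 (negPowers a n) := by
      obtain ⟨j, rfl⟩ := Nat.exists_eq_add_of_le' h1
      rcases Nat.eq_zero_or_pos j with rfl | hj
      · left; simp
      · right
        refine ⟨j, hj, by omega, ?_⟩
        rw [← zpow_one_add]
        congr 1
        push_cast
        ring
    have := hyx k' _ hmem
    simpa [shift, hk', mul_assoc] using this

/-- This is the argument of Hilbert's basis theorem. The groups `L n m` decrease in both indices;
stabilising the diagonal controls all rows `n ≥ r`, and the finitely many rows below `r` are
stabilised individually. -/
theorem ShiftDCC.of_cyclic_quotient {φ : N →* G} (hN : 𝒜.ShiftDCC N) (hφ : φ.range.Normal)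
    (a : G) (ha : ∀ g, ∃ k, ∃ i : ℤ, φ k * a ^ i = g) : 𝒜.ShiftDCC G := by
  rw [shiftDCC_iff] at hN ⊢
  intro X hX hS
  let L : ℕ → ℕ → Subgroup (N → A) := fun n m =>
    ArtinianStructure.leading φ (X m) (negPowers a n) 1
  have hL : ∀ {n n' m m'}, n ≤ n' → m ≤ m' → L n' m' ≤ L n m := fun h h' =>
    leading_mono (hX h') (negPowers_mono a h) 1
  obtain ⟨r, hr⟩ := hN (fun n => L n n) (fun i j hij => hL hij hij)
    fun n => (hS n).leading φ _ _
  have hs : ∀ n, ∃ s, ∀ m, s ≤ m → L n s = L n m := fun n =>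
    hN (L n) (fun i j hij => hL le_rfl hij) fun m => (hS m).leading φ _ _
  choose s hs using hs
  let q := max r ((Finset.range r).sup s)
  have key : ∀ m, q ≤ m → ∀ n, L n q ≤ L n m := by
    intro m hm n
    rcases lt_or_ge n r with hn | hn
    · have h1 : s n ≤ q := (Finset.le_sup (Finset.mem_range.2 hn)).trans (le_max_right _ _)
      exact ((hs n q h1).symm.trans (hs n m (h1.trans hm))).le
    · have h1 : L n q ≤ L r r := hL hn (le_max_left _ _)
      rw [show L r r = L (max n m) (max n m) from hr _ (hn.trans (le_max_left _ _))] at h1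
      exact h1.trans (hL (le_max_left _ _) (le_max_right _ _))
  refine ⟨q, fun m hm => le_antisymm (fun x hx => ?_) (hX hm)⟩
  have hagree := agreeOn_negPowers hφ (hS q).isSubshift (hS m).isSubshift (hX hm) a
    (key m hm)
  refine (hS m).isClosedSubgroup.mem_of_forall_finset fun E => ?_
  choose k i hi using ha
  -- Translating by `a ^ (-c)` makes all exponents of `E` at most `-1`, and `d` bounds their
  -- absolute values, so `E` lands in the cosets of `negPowers a d`.
  let c : ℕ := E.sup fun g => (i g + 1).toNat
  let d : ℕ := E.sup fun g => (c - i g).toNat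
  have hc : ∀ g ∈ E, i g + 1 ≤ c := fun g hg =>
    (Int.self_le_toNat _).trans (by exact_mod_cast Finset.le_sup (f := fun g => (i g + 1).toNat) hg)
  have hd : ∀ g ∈ E, c - i g ≤ d := fun g hg =>
    (Int.self_le_toNat _).trans (by exact_mod_cast Finset.le_sup (f := fun g => (c - i g).toNat) hg)
  obtain ⟨y, hy, hyx⟩ := hagree d (shift (a ^ (-c : ℤ)) x) ((hS q).isSubshift _ x hx)
  refine ⟨shift (a ^ (c : ℤ)) y, (hS m).isSubshift _ y hy, fun g hg => ?_⟩
  obtain ⟨k', hk'⟩ : a ^ (-c : ℤ) * φ (k g) * (a ^ (-c : ℤ))⁻¹ ∈ φ.range :=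
    hφ.conj_mem _ ⟨k g, rfl⟩ _
  have h1 := hc g hg
  have h2 := hd g hg
  have := hyx k' (a ^ (-(c - i g).toNat : ℤ)) ⟨_, by omega, by omega, rfl⟩
  have hg' : φ k' * a ^ (-(c - i g).toNat : ℤ) = a ^ (-c : ℤ) * g := by
    rw [hk', Int.toNat_of_nonneg (by omega)]
    conv_rhs => rw [← hi g]
    rw [mul_assoc, mul_assoc, ← zpow_neg, ← zpow_add]
    congr 3
    ring
  rw [hg'] at this
  simpa [shift, ← mul_assoc] using this

theorem ShiftDCC.of_isPolycyclic (hG : IsPolycyclic G) : 𝒜.ShiftDCC G := by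
  obtain ⟨n, H, h0, hn, hstep⟩ := hG
  have key : ∀ k ≤ n, 𝒜.ShiftDCC (H k) := by
    intro k
    induction k with
    | zero =>
      intro _
      rw [h0]
      exact shiftDCC_of_finite
    | succ k ih =>
      intro hk
      obtain ⟨hle, hnormal, hcyc⟩ := hstep k hk
      obtain ⟨b, hb⟩ := hcyc.exists_generator
      obtain ⟨a, rfl⟩ := QuotientGroup.mk_surjective b
      have hrange : (Subgroup.inclusion hle).range = (H k).subgroupOf (H (k + 1)) :=
        Subgroup.inclusion_range hle
      refine (ih (by omega)).of_cyclic_quotient (φ := Subgroup.inclusion hle)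
        (hrange ▸ hnormal) a fun g => ?_
      obtain ⟨i, hi⟩ := hb (g : H (k + 1) ⧸ (H k).subgroupOf (H (k + 1)))
      have hi' : ((a ^ i : H (k + 1)) : H (k + 1) ⧸ (H k).subgroupOf (H (k + 1))) = g := hi
      have hmem : g * (a ^ i)⁻¹ ∈ (Subgroup.inclusion hle).range := by
        rw [hrange]
        exact hnormal.mem_comm (QuotientGroup.eq.1 hi')
      obtain ⟨k', hk'⟩ := hmem
      exact ⟨k', i, by rw [hk']; simp⟩
  -- As `H n = ⊤`, a single coset suffices to pass from the subtype `H n` to the group itself.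
  refine (key n le_rfl).of_finite_cover (φ := (H n).subtype) {1} fun g => ?_
  exact ⟨⟨g, hn ▸ Subgroup.mem_top g⟩, 1, by simp⟩

theorem ShiftDCC.of_isPolycyclicByFinite (hG : IsPolycyclicByFinite G) : 𝒜.ShiftDCC G := by
  classical
  obtain ⟨N, hN, hfin, hpoly⟩ := hG
  have : Finite (G ⧸ N) := Subgroup.finite_quotient_of_finiteIndex
  have := Fintype.ofFinite (G ⧸ N)
  refine (ShiftDCC.of_isPolycyclic hpoly).of_finite_cover (φ := N.subtype)
    (Finset.univ.image fun q : G ⧸ N => q.out) fun g => ?_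
  have hmem : g * ((g : G ⧸ N).out)⁻¹ ∈ N :=
    hN.mem_comm (QuotientGroup.eq.1 (QuotientGroup.out_eq' (g : G ⧸ N)))
  exact ⟨⟨_, hmem⟩, _, Finset.mem_image_of_mem _ (Finset.mem_univ (g : G ⧸ N)), by simp⟩

end ArtinianStructure
end GroupShifts

/-! ### Images under cellular automata, and finite type -/

section CellularAutomata

variable {A : Type u} [Group A] {𝒜 : ArtinianStructure.{u, v} A} {G : Type v} [Group G]

/-- The homomorphism `x ↦ (x, loc x)`. -/
def graphHom {M : Type v} (loc : (M → A) →* A) : (M → A) →* (Option M → A) where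
  toFun x := fun o => o.elim (loc x) x
  map_one' := by ext (_ | _) <;> simp
  map_mul' x y := by ext (_ | _) <;> simp

namespace ArtinianStructure

/-- The graph of `t` over `X` is closed in `A^(G ⊕ G)`, being cut out by one cylinder condition for
each `g`. The image is its projection to the second factor, closed by `IsClosedSubgroup.map`. -/
theorem IsGroupShift.map_cellularAutomaton {M : Type v} [Finite M] (e : M → G)
    {loc : (M → A) →* A} (hloc : (graphHom loc).range ∈ 𝒜.alg (Option M))
    {t : (G → A) →* (G → A)} (ht : ∀ x g, t x g = loc fun m => x (g * e m))
    {X : Subgroup (G → A)} (hX : 𝒜.IsGroupShift X) : 𝒜.IsGroupShift (X.map t) where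
  isClosedSubgroup := by
    let E : G → Option M → G ⊕ G := fun g o => o.elim (.inr g) fun m => .inl (g * e m)
    let Γ : Subgroup (G ⊕ G → A) := X.comap (reindex A Sum.inl) ⊓
      ⨅ g, (graphHom loc).range.comap (reindex A (E g))
    have hΓ : 𝒜.IsClosedSubgroup Γ := (hX.isClosedSubgroup.comap _).inf
      (.iInf fun g => (isCylinder_comap _ hloc).isClosedSubgroup)
    have : X.map t = Γ.map (reindex A Sum.inr) := by
      ext y
      constructor
      · rintro ⟨x, hx, rfl⟩
        refine ⟨Sum.elim x (t x), ⟨hx, Subgroup.mem_iInf.2 fun g => ?_⟩, rfl⟩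
        refine ⟨fun m => x (g * e m), ?_⟩
        ext (_ | m)
        · exact (ht x g).symm
        · rfl
      · rintro ⟨z, ⟨hz, hz'⟩, rfl⟩
        refine ⟨_, hz, funext fun g => ?_⟩
        obtain ⟨w, hw⟩ := Subgroup.mem_iInf.1 hz' g
        have h1 : loc w = z (.inr g) := congrFun hw none
        have h2 : w = fun m => z (.inl (g * e m)) := funext fun m => congrFun hw (some m)
        rw [ht, reindex_apply, ← h1, h2]
        rfl
    rw [this]
    exact hΓ.map _
  isSubshift := by
    rintro g _ ⟨x, hx, rfl⟩
    refine ⟨shift g x, hX.isSubshift g x hx, funext fun h => ?_⟩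
    simp [shift, ht, mul_assoc]

/-- Under the descending chain condition every group shift is of finite type. -/
theorem IsGroupShift.exists_eq_subshiftOfFiniteType (hG : 𝒜.ShiftDCC G) {X : Subgroup (G → A)}
    (hX : 𝒜.IsGroupShift X) : ∃ D : Finset G, (X : Set (G → A)) = subshiftOfFiniteType D
      (X.map (reindex A (Subtype.val : D → G)) : Set (D → A)) := by
  classical
  let Y : Finset G → Subgroup (G → A) := fun D =>
    ⨅ g : G, (X.map (reindex A (Subtype.val : D → G))).comap (reindex A fun d : D => g * (d : G))
  have mem_Y : ∀ {D x}, x ∈ Y D ↔ ∀ g, ∃ y ∈ X, ∀ d ∈ D, y d = x (g * d) := by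
    intro D x
    simp only [Y, Subgroup.mem_iInf, Subgroup.mem_comap, Subgroup.mem_map, funext_iff,
      Subtype.forall, reindex_apply]
  have hY : ∀ D, 𝒜.IsGroupShift (Y D) := fun D =>
    { isClosedSubgroup := .iInf fun g => (isCylinder_comap _
        (hX.isClosedSubgroup.map _).mem_alg).isClosedSubgroup
      isSubshift := by
        intro g x hx
        refine mem_Y.2 fun h => ?_
        simpa [shift, mul_assoc] using mem_Y.1 hx (g⁻¹ * h) }
  have hXY : ∀ D, X ≤ Y D := fun D x hx => mem_Y.2 fun g =>
    ⟨shift g⁻¹ x, hX.isSubshift _ x hx, fun d _ => by simp [shift]⟩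
  -- `Y D` is the finite type subshift with the patterns of `X` on `D`. For a minimal one, enlarging
  -- the window to `D ∪ E` changes nothing, so its members agree with members of `X` on every finite
  -- `E`.
  obtain ⟨_, ⟨D, rfl⟩, hmin⟩ := hG.wf.has_min
    (Set.range fun D => (⟨Y D, hY D⟩ : {X : Subgroup (G → A) // 𝒜.IsGroupShift X}))
    (Set.range_nonempty _)
  have hle : Y D ≤ X := by
    intro x hx
    refine hX.isClosedSubgroup.mem_of_forall_finset fun E => ?_
    have h1 : Y (D ∪ E) ≤ Y D := fun z hz => mem_Y.2 fun g => by
      obtain ⟨y, hy, hyz⟩ := mem_Y.1 hz g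
      exact ⟨y, hy, fun d hd => hyz d (Finset.mem_union_left _ hd)⟩
    have h2 : Y (D ∪ E) = Y D := by
      by_contra hne
      exact hmin _ ⟨D ∪ E, rfl⟩ (lt_of_le_of_ne (show Y (D ∪ E) ≤ Y D from h1)
        fun h => hne (congrArg Subtype.val h))
    obtain ⟨y, hy, hyx⟩ := mem_Y.1 (h2 ▸ hx) 1
    exact ⟨y, hy, fun d hd => by simpa using hyx d (Finset.mem_union_right _ hd)⟩
  refine ⟨D, Set.ext fun x => (SetLike.ext_iff.1 (le_antisymm (hXY D) hle) x).trans ?_⟩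
  simp only [Y, Subgroup.mem_iInf, subshiftOfFiniteType, Set.mem_ofPred_eq]
  refine forall_congr' fun g => ?_
  have : D.restrict (shift g⁻¹ x) = reindex A (fun d : D => g * (d : G)) x := by
    funext d
    simp [shift]
  rw [this]
  rfl

end ArtinianStructure
end CellularAutomata

/-! ### Algebraic subgroups form an Artinian structure -/

section AlgebraicGroup

variable {K : Type u} [Field K] {V : Over (Spec (.of K))}

attribute [local instance] zariskiTopology

open CartesianMonoidalCategory

theorem pointMap_tuple {I J : Type v} [Finite I] [Finite J]
    (f : J → (power V I ⟶ V)) (x : I → Points V) (j : J) :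
    pointMap (tuple f) x j = tuple x ≫ f j := by
  rw [pointMap, Category.assoc, tuple_π]

theorem reindex_eq_pointMap [GrpObj V] {I J : Type v} [Finite I] [Finite J] (e : J → I)
    (x : I → Points V) :
    reindex (Points V) e x = pointMap (tuple fun j => Pi.π (fun _ : I => V) (e j)) x := by
  funext j
  rw [pointMap_tuple, tuple_π, reindex_apply]

/-- Translation by a `K`-point comes from a morphism of schemes. Only separate continuity is sought,
since the Zariski topology of a product is not the product topology. -/
theorem continuous_mul_left_zariski [GrpObj V] {I : Type v} [Finite I] (a : I → Points V) :
    Continuous fun x : I → Points V => a * x := by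
  have : (fun x : I → Points V => a * x) =
      pointMap (tuple fun i => (toUnit _ ≫ a i) * Pi.π (fun _ : I => V) i) := by
    funext x i
    rw [pointMap_tuple, MonObj.comp_mul, tuple_π, ← Category.assoc, toUnit_unique (_ ≫ _) (𝟙 _),
      Category.id_comp, Pi.mul_apply]
  rw [this]
  exact continuous_pointMap _

theorem continuous_mul_right_zariski [GrpObj V] {I : Type v} [Finite I] (a : I → Points V) :
    Continuous fun x : I → Points V => x * a := by
  have : (fun x : I → Points V => x * a) =
      pointMap (tuple fun i => Pi.π (fun _ : I => V) i * (toUnit _ ≫ a i)) := by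
    funext x i
    rw [pointMap_tuple, MonObj.comp_mul, tuple_π, ← Category.assoc, toUnit_unique (_ ≫ _) (𝟙 _),
      Category.id_comp, Pi.mul_apply]
  rw [this]
  exact continuous_pointMap _

theorem continuous_inv_zariski [GrpObj V] {I : Type v} [Finite I] :
    Continuous fun x : I → Points V => x⁻¹ := by
  have : (fun x : I → Points V => x⁻¹) =
      pointMap (tuple fun i => (Pi.π (fun _ : I => V) i)⁻¹) := by
    funext x i
    rw [pointMap_tuple, GrpObj.comp_inv, tuple_π, Pi.inv_apply]
  rw [this]
  exact continuous_pointMap _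

variable [IsAlgClosed K] [GrpObj V]

/-- The image is constructible by Chevalley and a subgroup, hence closed. -/
theorem IsFiniteType.isClosed_map (hV : IsFiniteType V) {I J : Type v} [Finite I] [Finite J]
    (f : power V I ⟶ power V J) {φ : (I → Points V) →* (J → Points V)}
    (hφ : ∀ x, φ x = pointMap f x) {W : Subgroup (I → Points V)}
    (hW : IsClosed (W : Set (I → Points V))) :
    IsClosed (W.map φ : Set (J → Points V)) := by
  have := hV.noetherianSpace J
  have : SeparatelyContinuousMul (J → Points V) :=
    ⟨fun {a} => continuous_mul_left_zariski a, fun {a} => continuous_mul_right_zariski a⟩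
  have : ContinuousInv (J → Points V) := ⟨continuous_inv_zariski⟩
  refine isClosed_of_isConstructible_subgroup _ ?_
  rw [Subgroup.coe_map, show (φ : (I → Points V) → _) = pointMap f from funext hφ]
  exact hV.isConstructible_image_pointMap f hW

/-- The algebraic subgroups of the powers of an algebraic group. -/
@[reducible] noncomputable def IsFiniteType.artinianStructure (hV : IsFiniteType V) :
    ArtinianStructure.{u, v} (Points V) where
  alg I _ := {W | IsClosed (W : Set (I → Points V))}
  top_mem _ _ := isClosed_univ
  bot_mem I _ := by
    have : ((⊥ : Subgroup (I → Points V)) : Set (I → Points V)) = pointOf ⁻¹' {pointOf 1} := by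
      ext x
      simp [hV.pointOf_injective.eq_iff]
    change IsClosed _
    rw [this]
    exact (hV.isClosed_pointOf 1).preimage continuous_pointOf
  inf_mem h h' := IsClosed.inter h h'
  comap_mem e W hW := by
    have : Continuous (reindex (Points V) e) := by
      rw [show (reindex (Points V) e : _ → _) = _ from funext (reindex_eq_pointMap e)]
      exact continuous_pointMap _
    exact IsClosed.preimage this hW
  map_mem e W hW := hV.isClosed_map _ (reindex_eq_pointMap e) hW
  wellFoundedLT I _ := by
    have := hV.noetherianSpace I
    let c : {W : Subgroup (I → Points V) | IsClosed (W : Set (I → Points V))} →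
      TopologicalSpace.Closeds (I → Points V) := fun W => ⟨W.1, W.2⟩
    have hc : StrictMono c := fun W W' h => h
    exact hc.wellFoundedLT

theorem IsFiniteType.mem_alg_iff (hV : IsFiniteType V) {I : Type v} [Finite I]
    {W : Subgroup (I → Points V)} :
    W ∈ hV.artinianStructure.alg I ↔ IsAlgebraicSubgroup (W : Set (I → Points V)) :=
  ⟨fun h => ⟨⟨W, rfl⟩, isZariskiClosed_iff.2 h⟩, fun h => isZariskiClosed_iff.1 h.2⟩

/-- The homomorphism on `K`-points given by a homomorphism of algebraic groups. -/
noncomputable def IsAlgebraicGroupHom.toMonoidHom {I : Type v} [Finite I] {f : power V I ⟶ V}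
    (hf : IsAlgebraicGroupHom f) : (I → Points V) →* Points V :=
  MonoidHom.mk' (fun x => tuple x ≫ f) (hf _)

theorem IsFiniteType.range_graphHom_mem (hV : IsFiniteType V) {I : Type v} [Finite I]
    {f : power V I ⟶ V} (hf : IsAlgebraicGroupHom f) :
    (graphHom hf.toMonoidHom).range ∈ hV.artinianStructure.alg (Option I) := by
  rw [MonoidHom.range_eq_map]
  refine hV.isClosed_map (tuple fun o => o.elim f (Pi.π (fun _ : I => V))) (fun x => ?_)
    isClosed_univ
  refine funext fun o => ?_
  rcases o with _ | i
  · rw [pointMap_tuple]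
    rfl
  · rw [pointMap_tuple]
    exact (tuple_π x i).symm

end AlgebraicGroup

theorem IsProdiscreteClosed.mem_of_forall_finset {G : Type v} {A : Type u} {X : Set (G → A)}
    (hX : IsProdiscreteClosed X) {x : G → A}
    (h : ∀ E : Finset G, ∃ y ∈ X, ∀ g ∈ E, y g = x g) : x ∈ X := by
  let _ : TopologicalSpace A := ⊥
  by_contra hx
  obtain ⟨E, U, hU, hEU⟩ := isOpen_pi_iff.1 (show IsOpen Xᶜ from hX.isOpen_compl) x hx
  obtain ⟨y, hy, hyx⟩ := h E
  exact hEU (fun g hg => by rw [hyx g hg]; exact (hU g hg).2) hy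

/-- Only the finite restrictions of `X` are assumed to be subgroups. Prodiscrete closedness recovers
`X` from them, as an intersection of cylinder subgroups. -/
theorem IsAlgebraicGroupSubshift.exists_isGroupShift {G : Type v} [Group G] {K : Type u} [Field K]
    [IsAlgClosed K] {V : Over (Spec (.of K))} [GrpObj V] (hV : IsFiniteType V)
    {X : Set (G → Points V)} (hX : IsAlgebraicGroupSubshift X) :
    ∃ Y : Subgroup (G → Points V), (Y : Set (G → Points V)) = X ∧
      hV.artinianStructure.IsGroupShift Y := by
  choose H hH using fun E => (hX.isAlgebraicSubgroup E).1
  have mem_iff : ∀ x, x ∈ X ↔ ∀ E, E.restrict x ∈ H E := by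
    intro x
    have mem_H : ∀ E, E.restrict x ∈ H E ↔ ∃ y ∈ X, ∀ g ∈ E, y g = x g := by
      intro E
      rw [← SetLike.mem_coe, hH]
      simp [restrictSet, funext_iff]
    simp only [mem_H]
    exact ⟨fun h E => ⟨x, h, fun _ _ => rfl⟩, hX.isClosed.mem_of_forall_finset⟩
  let Y : Subgroup (G → Points V) := ⨅ E, (H E).comap (reindex _ (Subtype.val : E → G))
  have hY : (Y : Set (G → Points V)) = X := by
    ext x
    rw [SetLike.mem_coe, Subgroup.mem_iInf, mem_iff]
    rfl
  refine ⟨Y, hY, .iInf fun E => (ArtinianStructure.isCylinder_comap _ ?_).isClosedSubgroup, ?_⟩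
  · rw [hV.mem_alg_iff, hH]
    exact hX.isAlgebraicSubgroup E
  · rw [hY]
    exact hX.isSubshift

end AlgShift

/-! ### Stabilisation of the iterated images -/

theorem corollaryc {G : Type v} [Group G] (hG : AlgShift.IsPolycyclicByFinite G)
    {K : Type u} [Field K] [IsAlgClosed K]
    (V : Over (Spec (.of K))) [GrpObj V] [LocallyOfFiniteType V.hom] [QuasiCompact V.hom]
    (X : Set (G → AlgShift.Points V)) (hX : AlgShift.IsAlgebraicGroupSubshift X)
    (τ : X → X) (hτ : AlgShift.IsAlgebraicGroupCellularAutomatonOn τ) :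
    AlgShift.IsAlgebraicGroupSubshiftOfFiniteType
        (Subtype.val '' AlgShift.limitSet τ : Set (G → AlgShift.Points V)) ∧
      AlgShift.IsStable τ := by
  have hV : AlgShift.IsFiniteType V := ⟨inferInstance, inferInstance⟩
  obtain ⟨Z, rfl, hZ⟩ := hX.exists_isGroupShift hV
  have hDCC := AlgShift.ArtinianStructure.ShiftDCC.of_isPolycyclicByFinite
    (𝒜 := hV.artinianStructure) hG
  obtain ⟨t, ⟨M, f, hf, ht⟩, hτt⟩ := hτ
  have ht' : ∀ x g, t x g = hf.toMonoidHom fun m : M => x (g * m) := by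
    intro x g
    rw [ht]
    change AlgShift.tuple _ ≫ f = AlgShift.tuple _ ≫ f
    congr 2
    funext m
    simp [AlgShift.shift]
  let T : (G → AlgShift.Points V) →* (G → AlgShift.Points V) := MonoidHom.mk' t fun x y => by
    funext g
    rw [Pi.mul_apply, ht', ht', ht', ← map_mul]
    rfl
  -- `Y n` is `τ^n(Σ)`, seen as a subgroup of the full shift.
  let Y : ℕ → Subgroup (G → AlgShift.Points V) := fun n => (Subgroup.map T)^[n] Z
  have Y_succ : ∀ n, Y (n + 1) = (Y n).map T := fun n => Function.iterate_succ_apply' _ _ _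
  have hY : ∀ n, hV.artinianStructure.IsGroupShift (Y n) := by
    intro n
    induction n with
    | zero => exact hZ
    | succ n ih =>
      rw [Y_succ]
      exact ih.map_cellularAutomaton (Subtype.val : M → G) (hV.range_graphHom_mem hf) ht'
  have hanti : Antitone Y := by
    refine antitone_nat_of_succ_le fun n => ?_
    induction n with
    | zero =>
      rintro _ ⟨x, hx, rfl⟩
      have := (τ ⟨x, hx⟩).2
      rwa [hτt] at this
    | succ n ih =>
      rw [Y_succ (n + 1)]
      conv_rhs => rw [Y_succ n]
      exact Subgroup.map_mono ih
  have mem_range : ∀ n (x : (Z : Set (G → AlgShift.Points V))),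
      x ∈ Set.range τ^[n] ↔ (x : G → AlgShift.Points V) ∈ Y n := by
    intro n
    induction n with
    | zero => exact fun x => ⟨fun _ => x.2, fun _ => ⟨x, rfl⟩⟩
    | succ n ih =>
      intro x
      rw [Y_succ]
      constructor
      · rintro ⟨y, rfl⟩
        rw [Function.iterate_succ_apply']
        exact ⟨_, (ih _).1 ⟨y, rfl⟩, (hτt _).symm⟩
      · rintro ⟨z, hz, hzx⟩
        obtain ⟨y, hy⟩ := (ih ⟨z, hanti n.zero_le hz⟩).2 hz
        refine ⟨y, Subtype.ext ?_⟩
        rw [Function.iterate_succ_apply', hy, hτt]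
        exact hzx
  obtain ⟨n, hn⟩ := AlgShift.ArtinianStructure.shiftDCC_iff.1 hDCC Y hanti hY
  have hlimit : (Subtype.val '' AlgShift.limitSet τ : Set (G → AlgShift.Points V)) = Y n := by
    ext x
    constructor
    · rintro ⟨x, hx, rfl⟩
      -- The limit set intersects only over positive exponents, and `n` may be `0`.
      rw [hn (n + 1) n.le_succ]
      exact (mem_range _ x).1 (Set.mem_iInter₂.1 hx (n + 1) (by omega))
    · intro hx
      refine ⟨⟨x, hanti n.zero_le hx⟩, Set.mem_iInter₂.2 fun m _ => (mem_range m _).2 ?_, rfl⟩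
      rcases le_total m n with h | h
      · exact hanti h hx
      · exact hn m h ▸ hx
  refine ⟨?_, n + 1, by omega, ?_⟩
  · obtain ⟨D, hD⟩ := (hY n).exists_eq_subshiftOfFiniteType hDCC
    exact ⟨D, _, hV.mem_alg_iff.1 ((hY n).isClosedSubgroup.map _).mem_alg, hlimit.trans hD⟩
  · ext x
    rw [mem_range, mem_range, ← hn (n + 1) (by omega), ← hn (n + 1 + 1) (by omega)]
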